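/- For $n\ge 1$ let $X^n$ be uniform on $\{-1,1\}^n$ and let $Y^n$ be obtained from $X^n$ by flipping each coordinate independently with probability $\delta$; write $\rho=1-2\delta$ and, for $f:\{-1,1\}^n\to\{-1,1\}$, $T_\rho f(y^n)=\mathbb E\left(f(X^n)\mid Y^n=y^n\right)$. The function $f$ is called $\rho$-self-predicting ($\rho$-SP) if for every $y^n\in\{-1,1\}^n$ with $T_\rho f(y^n)\ne 0$ one has $f(y^n)=\operatorname{sgn}T_\rho f(y^n)$. Let $h(t)=-t\log_2 t-(1-t)\log_2(1-t)$ and $d(p\|q)=p\log_2\frac pq+(1-p)\log_2\frac{1-p}{1-q}$ (with $0\log_2 0=0$). For $\delta\in(0,1/2)$ let $\eta_\delta$ be the infimum of all $\eta\in(\delta,1]$ such that $$\frac12\log_2\frac1{\delta^2+(1-\delta)^2}<\min\left\{\log_2\frac1{1-\delta},\,d(\eta\|\delta)\right\},$$ and let $\delta_{\max}$ be the largest number in $[0,1/2]$ such that $\eta_\delta<1/4$ for all $\delta\in(0,\delta_{\max})$. Theorem. We have $\delta_{\max}\approx 0.0974$ (correct to four decimal places). For every $\delta\in(0,\delta_{\max})$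 we have $\delta<\eta_\delta<1/4$, and the fraction of $\rho$-SP functions, $\rho=1-2\delta$, among all $2^{2^n}$ Boolean functions on $\{-1,1\}^n$ is at most $$\exp\left(-2^{\,n[1-h(2\eta_\delta)]-o(n)}\right)\qquad(n\to\infty);$$ that is, there is a sequence $e_n=o(n)$ (which may depend on $\delta$) such that the fraction is at most $\exp\left(-2^{\,n[1-h(2\eta_\delta)]-e_n}\right)$ for all sufficiently large $n$. -/

import Mathlib

open Filter Asymptotics

noncomputable section

namespace SelfPredicting

/-- The Hamming cube `{-1,1}^n`; the alphabet `{-1,1}` is `ℤˣ`. -/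
abbrev Cube (n : ℕ) : Type := Fin n → ℤˣ

/-- Boolean functions `f : {-1,1}^n → {-1,1}`. -/
abbrev BoolFn (n : ℕ) : Type := Cube n → ℤˣ

/-- Joint probability mass function of `(X^n, Y^n)`: `X^n` is uniform on the cube and `Y^n` is
obtained by flipping each coordinate of `X^n` independently with probability `δ`. -/
def jointProb (δ : ℝ) {n : ℕ} (x y : Cube n) : ℝ :=
  (1 / 2 ^ n) * ∏ i, if x i = y i then 1 - δ else δ

/-- Conditional probability mass function `p(x^n ∣ y^n)`. -/
def condProb (δ : ℝ) {n : ℕ} (x y : Cube n) : ℝ :=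
  jointProb δ x y / ∑ z, jointProb δ z y

/-- Noise operator `T_ρ f(y) = E(f(X^n) ∣ Y^n = y)` for correlation `ρ = 1 - 2δ`,
that is, crossover probability `δ = (1 - ρ) / 2`. -/
def noiseOp (ρ : ℝ) {n : ℕ} (f : BoolFn n) (y : Cube n) : ℝ :=
  ∑ x, condProb ((1 - ρ) / 2) x y * ((f x : ℤ) : ℝ)

/-- `f` is `ρ`-self-predicting at `y`: it agrees with the optimal predictor `sgn T_ρ f(y)`
whenever that predictor is not tied. -/
def IsSPAt (ρ : ℝ) {n : ℕ} (f : BoolFn n) (y : Cube n) : Prop :=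
  noiseOp ρ f y ≠ 0 → ((f y : ℤ) : ℝ) = Real.sign (noiseOp ρ f y)

/-- `f` is `ρ`-self-predicting. -/
def IsSP (ρ : ℝ) {n : ℕ} (f : BoolFn n) : Prop :=
  ∀ y, IsSPAt ρ f y

/-- The fraction of `ρ`-self-predicting functions among all Boolean functions on `{-1,1}^n`. -/
def fractionSP (ρ : ℝ) (n : ℕ) : ℝ :=
  (Nat.card {f : BoolFn n // IsSP ρ f} : ℝ) / (Nat.card (BoolFn n) : ℝ)

/-- Binary entropy function, in bits. -/
def binEnt (t : ℝ) : ℝ :=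
  -t * Real.logb 2 t - (1 - t) * Real.logb 2 (1 - t)

/-- Binary divergence function, in bits. -/
def binDiv (p q : ℝ) : ℝ :=
  p * Real.logb 2 (p / q) + (1 - p) * Real.logb 2 ((1 - p) / (1 - q))

/-- The condition on the relative radius `η` that determines `η_δ`. -/
def EtaCondition (δ η : ℝ) : Prop :=
  (1 / 2) * Real.logb 2 (1 / (δ ^ 2 + (1 - δ) ^ 2)) <
    min (Real.logb 2 (1 / (1 - δ))) (binDiv η δ)

/-- `η_δ`: the infimum of the relative radii `η ∈ (δ, 1]` that satisfy the condition. -/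
def eta (δ : ℝ) : ℝ :=
  sInf {η : ℝ | δ < η ∧ η ≤ 1 ∧ EtaCondition δ η}

/-- `δ_max`: the largest threshold (at most `1/2`) such that `η_δ < 1/4` for every `δ` below it. -/
def deltaMax : ℝ :=
  sSup {d : ℝ | 0 ≤ d ∧ d ≤ 1 / 2 ∧ ∀ δ : ℝ, 0 < δ → δ < d → eta δ < 1 / 4}

end SelfPredicting

end

/-!
For uniformly random `f` and a fixed `y`, the value `T_ρ f(y)` is a Rademacher sum whose standard
deviation is `2 ^ (-n R)`, where `R` is half of `log₂ (1 / (δ² + (1 - δ)²))`. If `R` is smaller than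
`log₂ (1 / (1 - δ))` and `d(η ‖ δ)`, this dominates both the weight `(1 - δ) ^ n` of `y` itself and,
by the Chernoff bound, the total weight of the points at distance more than `η n` from `y`. By the
fourth-moment Khintchine inequality, the Paley–Zygmund inequality and symmetry, with probability at
least `1 / 8` the other points of the ball of radius `η n` about `y` outvote `f y` together with
everything outside the ball, and then `f` is not self-predicting at `y`. These events are
independent for disjoint balls, and the Gilbert–Varshamov bound provides `2 ^ (n (1 - h(2 η)))`
disjoint balls.

By convexity of `d(· ‖ δ)`, the condition `η_δ < 1 / 4` says that `R < d(1 / 4 ‖ δ)`. Since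
`4 (d(1 / 4 ‖ δ) - R)` is the binary logarithm of a rational function of `δ`, this is a polynomial
inequality, which locates `δ_max`.
-/

namespace SelfPredicting

open Finset
open scoped BigOperators

section FiniteProbability

theorem sq_expect_sub_le_expect_sq_mul_dens {Ω : Type*} [Fintype Ω] [Nonempty Ω] (Z : Ω → ℝ)
    {θ : ℝ} (hθ : 0 ≤ θ) (hθZ : θ ≤ 𝔼 ω, Z ω) :
    (𝔼 ω, Z ω - θ) ^ 2 ≤ (𝔼 ω, Z ω ^ 2) * (dens {ω | θ < Z ω} : ℝ) := by
  have htrunc : 𝔼 ω, Z ω - θ ≤ 𝔼 ω, Z ω * if θ < Z ω then 1 else 0 := by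
    calc 𝔼 ω, Z ω - θ = 𝔼 ω, (Z ω - θ) := by rw [expect_sub_distrib, Fintype.expect_const]
      _ ≤ 𝔼 ω, Z ω * if θ < Z ω then 1 else 0 := expect_le_expect fun ω _ => by
        split_ifs <;> linarith
  have hind : 𝔼 ω, (if θ < Z ω then (1 : ℝ) else 0) ^ 2 = (dens {ω | θ < Z ω} : ℝ) := by
    rw [← expect_indicator_one]
    exact expect_congr rfl fun ω _ => by by_cases h : θ < Z ω <;> simp [h]
  calc (𝔼 ω, Z ω - θ) ^ 2
      ≤ (𝔼 ω, Z ω * if θ < Z ω then 1 else 0) ^ 2 := by gcongr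
    _ ≤ (𝔼 ω, Z ω ^ 2) * 𝔼 ω, (if θ < Z ω then (1 : ℝ) else 0) ^ 2 :=
        expect_mul_sq_le_sq_mul_sq _ _ _
    _ = (𝔼 ω, Z ω ^ 2) * (dens {ω | θ < Z ω} : ℝ) := by rw [hind]

variable {α ι : Type*} {β : α → Type*} [Fintype α] [DecidableEq α] [∀ a, Fintype (β a)]

/-- Exchanging the coordinates in `S` between two independent copies preserves the uniform
distribution and turns the joint event into a product event. -/
theorem dens_filter_and_eq_mul_of_dependsOn (P Q : (∀ a, β a) → Prop) [DecidablePred P]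
    [DecidablePred Q] (S : Finset α) (hP : DependsOn P S) (hQ : DependsOn Q (S : Set α)ᶜ) :
    dens {f | P f ∧ Q f} = dens {f | P f} * dens {f | Q f} := by
  let swap (p : (∀ a, β a) × (∀ a, β a)) := (S.piecewise p.1 p.2, S.piecewise p.2 p.1)
  have hswap : Function.Involutive swap := fun p => by
    simp [swap, Finset.piecewise_same]
  have hcard : #{f | P f ∧ Q f} * #(univ : Finset (∀ a, β a)) = #{f | P f} * #{f | Q f} := by
    rw [← card_product, ← card_product]
    refine card_bijective swap hswap.bijective fun p => ?_
    have hP' : P (S.piecewise p.1 p.2) = P p.1 :=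
      hP fun a ha => S.piecewise_eq_of_mem _ _ ha
    have hQ' : Q (S.piecewise p.2 p.1) = Q p.1 :=
      hQ fun a ha => S.piecewise_eq_of_notMem _ _ ha
    simp [swap, hP', hQ']
  rcases isEmpty_or_nonempty (∀ a, β a) with hempty | hnonempty
  · simp [Subsingleton.elim _ (∅ : Finset (∀ a, β a))]
  · have hN : (Fintype.card (∀ a, β a) : ℚ≥0) ≠ 0 := mod_cast Fintype.card_ne_zero
    simp only [dens]
    field_simp
    exact_mod_cast hcard

theorem dens_filter_forall_eq_prod_of_dependsOn [∀ a, Nonempty (β a)]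
    (C : Finset ι) (P : ι → (∀ a, β a) → Prop)
    [∀ i, DecidablePred (P i)] (B : ι → Finset α) (hB : (C : Set ι).PairwiseDisjoint B)
    (hP : ∀ i ∈ C, DependsOn (P i) (B i : Set α)) :
    dens {f | ∀ i ∈ C, P i f} = ∏ i ∈ C, dens {f | P i f} := by
  classical
  induction C using Finset.induction_on with
  | empty => simp
  | insert j C hj ih =>
    rw [coe_insert, Set.pairwiseDisjoint_insert_of_notMem (mod_cast hj)] at hB
    have hrest : DependsOn (fun f => ∀ i ∈ C, P i f) (B j : Set α)ᶜ := fun f g hfg =>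
      propext <| forall₂_congr fun i hi => iff_of_eq <| hP i (mem_insert_of_mem hi) fun a ha =>
        hfg a fun haj => disjoint_left.1 (hB.2 i hi) haj ha
    simp only [forall_mem_insert, prod_insert hj]
    rw [dens_filter_and_eq_mul_of_dependsOn _ _ (B j) (hP j (mem_insert_self j C)) hrest,
      ih hB.1 fun i hi => hP i (mem_insert_of_mem hi)]

end FiniteProbability

section Rademacher

variable {α : Type*}

/-- The weighted sum of signs `∑ x ∈ s, a x * f x`. For uniformly random `f` it is a Rademacher
sum. -/
def signSum (a : α → ℝ) (s : Finset α) (f : α → ℤˣ) : ℝ :=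
  ∑ x ∈ s, a x * ((f x : ℤ) : ℝ)

theorem abs_cast_units (u : ℤˣ) : |((u : ℤ) : ℝ)| = 1 := by
  rcases Int.units_eq_one_or u with rfl | rfl <;> simp

theorem cast_units_sq (u : ℤˣ) : ((u : ℤ) : ℝ) ^ 2 = 1 := by
  rw [← sq_abs, abs_cast_units, one_pow]

theorem mul_signSum_le_sum {a : α → ℝ} {s : Finset α} (ha : ∀ x ∈ s, 0 ≤ a x) (u : ℤˣ)
    (f : α → ℤˣ) : ((u : ℤ) : ℝ) * signSum a s f ≤ ∑ x ∈ s, a x := by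
  rw [signSum, mul_sum]
  refine sum_le_sum fun x hx => (le_abs_self _).trans_eq ?_
  rw [abs_mul, abs_mul, abs_cast_units, abs_cast_units, abs_of_nonneg (ha x hx), one_mul, mul_one]

theorem dependsOn_signSum (a : α → ℝ) (s : Finset α) : DependsOn (signSum a s) (s : Set α) :=
  fun _ _ hfg => sum_congr rfl fun x hx => by rw [hfg x hx]

variable [DecidableEq α]

/-- The involution of `α → ℤˣ` that flips the sign at `y`. -/
def flipAt (y : α) (f : α → ℤˣ) : α → ℤˣ := Function.update f y (-f y)

theorem flipAt_involutive (y : α) : Function.Involutive (flipAt y) := fun f => by simp [flipAt]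

@[simp] theorem flipAt_self (y : α) (f : α → ℤˣ) : flipAt y f y = -f y := by simp [flipAt]

theorem signSum_flipAt (a : α → ℝ) {s : Finset α} {y : α} (hy : y ∉ s) (f : α → ℤˣ) :
    signSum a s (flipAt y f) = signSum a s f :=
  dependsOn_signSum a s fun _ hx => Function.update_of_ne (ne_of_mem_of_not_mem hx hy) _ _

theorem signSum_insert (a : α → ℝ) {s : Finset α} {y : α} (hy : y ∉ s) (f : α → ℤˣ) :
    signSum a (insert y s) f = a y * ((f y : ℤ) : ℝ) + signSum a s f :=
  sum_insert hy

variable [Fintype α]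

theorem expect_eq_expect_average_flipAt (y : α) (F : (α → ℤˣ) → ℝ) :
    𝔼 f, F f = 𝔼 f, (F f + F (flipAt y f)) / 2 := by
  have hflip : 𝔼 f, F (flipAt y f) = 𝔼 f, F f :=
    Fintype.expect_equiv (flipAt_involutive y).toPerm _ _ fun _ => rfl
  rw [← expect_div, expect_add_distrib, hflip, add_self_div_two]

theorem expect_signSum_sq (a : α → ℝ) (s : Finset α) :
    𝔼 f, signSum a s f ^ 2 = ∑ x ∈ s, a x ^ 2 := by
  induction s using Finset.induction_on with
  | empty => simp [signSum]
  | insert y s hy ih =>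
    calc 𝔼 f, signSum a (insert y s) f ^ 2
        = 𝔼 f, (a y ^ 2 + signSum a s f ^ 2) := by
          rw [expect_eq_expect_average_flipAt y]
          refine expect_congr rfl fun f _ => ?_
          rw [signSum_insert a hy, signSum_insert a hy, signSum_flipAt a hy, flipAt_self]
          push_cast
          linear_combination a y ^ 2 * cast_units_sq (f y)
      _ = ∑ x ∈ insert y s, a x ^ 2 := by
          rw [expect_add_distrib, Fintype.expect_const, ih, sum_insert hy]

theorem expect_signSum_pow_four_le (a : α → ℝ) (s : Finset α) :
    𝔼 f, signSum a s f ^ 4 ≤ 3 * (∑ x ∈ s, a x ^ 2) ^ 2 := by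
  induction s using Finset.induction_on with
  | empty => simp [signSum]
  | insert y s hy ih =>
    calc 𝔼 f, signSum a (insert y s) f ^ 4
        = 𝔼 f, (a y ^ 4 + 6 * a y ^ 2 * signSum a s f ^ 2 + signSum a s f ^ 4) := by
          rw [expect_eq_expect_average_flipAt y]
          refine expect_congr rfl fun f _ => ?_
          rw [signSum_insert a hy, signSum_insert a hy, signSum_flipAt a hy, flipAt_self]
          push_cast
          linear_combination (a y ^ 4 * (((f y : ℤ) : ℝ) ^ 2 + 1)
            + 6 * a y ^ 2 * signSum a s f ^ 2) * cast_units_sq (f y)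
      _ = a y ^ 4 + 6 * a y ^ 2 * ∑ x ∈ s, a x ^ 2 + 𝔼 f, signSum a s f ^ 4 := by
          rw [expect_add_distrib, expect_add_distrib, Fintype.expect_const, ← mul_expect,
            expect_signSum_sq]
      _ ≤ a y ^ 4 + 6 * a y ^ 2 * ∑ x ∈ s, a x ^ 2 + 3 * (∑ x ∈ s, a x ^ 2) ^ 2 := by gcongr
      _ ≤ 3 * (a y ^ 2 + ∑ x ∈ s, a x ^ 2) ^ 2 := by nlinarith [sq_nonneg (a y ^ 2)]
      _ = 3 * (∑ x ∈ insert y s, a x ^ 2) ^ 2 := by rw [sum_insert hy]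

theorem one_fourth_le_dens_lt_abs_signSum {a : α → ℝ} {s : Finset α} {t : ℝ}
    (hs : 0 < ∑ x ∈ s, a x ^ 2) (ht : 8 * t ^ 2 ≤ ∑ x ∈ s, a x ^ 2) :
    1 / 4 ≤ dens {f | t < |signSum a s f|} := by
  set v := ∑ x ∈ s, a x ^ 2
  set p : ℝ := ((dens {f | t ^ 2 < signSum a s f ^ 2} : ℚ≥0) : ℝ)
  have hpz : (v - t ^ 2) ^ 2 ≤ (𝔼 f, (signSum a s f ^ 2) ^ 2) * p := by
    have hθ : t ^ 2 ≤ 𝔼 f, signSum a s f ^ 2 := by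
      rw [expect_signSum_sq]
      nlinarith
    have h := sq_expect_sub_le_expect_sq_mul_dens (fun f => signSum a s f ^ 2) (sq_nonneg t) hθ
    rwa [expect_signSum_sq] at h
  have hfourth : 𝔼 f, (signSum a s f ^ 2) ^ 2 ≤ 3 * v ^ 2 := by
    simpa only [← pow_mul] using expect_signSum_pow_four_le a s
  have hp : v ^ 2 * (1 / 4) ≤ v ^ 2 * p :=
    calc v ^ 2 * (1 / 4) ≤ (v - t ^ 2) ^ 2 / 3 := by nlinarith
      _ ≤ 3 * v ^ 2 * p / 3 := by gcongr; exact hpz.trans (by gcongr)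
      _ = v ^ 2 * p := by ring
  have hsub : dens {f | t ^ 2 < signSum a s f ^ 2} ≤ dens {f | t < |signSum a s f|} :=
    dens_le_dens <| monotone_filter_right _ fun f _ hf =>
      (le_abs_self t).trans_lt (sq_lt_sq.1 hf)
  have hquarter : ((1 / 4 : ℚ≥0) : ℝ) ≤ p := by
    push_cast
    exact le_of_mul_le_mul_left hp (by positivity)
  exact (NNRat.cast_le.1 hquarter).trans hsub

theorem one_eighth_le_dens_mul_signSum_lt {a : α → ℝ} {s : Finset α} {y : α} (hy : y ∉ s) {t : ℝ}
    (hs : 0 < ∑ x ∈ s, a x ^ 2) (ht : 8 * t ^ 2 ≤ ∑ x ∈ s, a x ^ 2) :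
    1 / 8 ≤ dens {f | ((f y : ℤ) : ℝ) * signSum a s f < -t} := by
  have hsymm : dens {f | t < ((f y : ℤ) : ℝ) * signSum a s f} =
      dens {f | ((f y : ℤ) : ℝ) * signSum a s f < -t} := by
    rw [dens, dens, card_bijective (flipAt y) (flipAt_involutive y).bijective fun f => ?_]
    simp [signSum_flipAt a hy, neg_mul]
  have hunion : dens {f | t < |signSum a s f|} ≤
      dens {f | t < ((f y : ℤ) : ℝ) * signSum a s f} +
        dens {f | ((f y : ℤ) : ℝ) * signSum a s f < -t} := by
    refine (dens_le_dens fun f hf => ?_).trans (dens_union_le _ _)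
    have habs : |signSum a s f| = |((f y : ℤ) : ℝ) * signSum a s f| := by
      rw [abs_mul, abs_cast_units, one_mul]
    rw [mem_filter_univ, habs, lt_abs, lt_neg] at hf
    simpa only [mem_union, mem_filter_univ] using hf
  rw [hsymm, ← two_mul] at hunion
  have hquarter := (one_fourth_le_dens_lt_abs_signSum hs ht).trans hunion
  rw [← NNRat.coe_le_coe] at hquarter ⊢
  push_cast at hquarter ⊢
  linarith

/-- The points of `B` other than `y` outvote `f y`: with weights `a`, they favour the sign `-f y` by
more than the joint weight of `y` and of all points outside `B`. -/
def IsOutvoted (a : α → ℝ) (B : Finset α) (y : α) (f : α → ℤˣ) : Prop :=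
  ((f y : ℤ) : ℝ) * signSum a (B.erase y) f < -(a y + ∑ x ∈ Bᶜ, a x)

noncomputable instance (a : α → ℝ) (B : Finset α) (y : α) : DecidablePred (IsOutvoted a B y) :=
  fun _ => inferInstanceAs (Decidable (_ < _))

theorem IsOutvoted.mul_signSum_univ_neg {a : α → ℝ} (ha : ∀ x, 0 ≤ a x) {B : Finset α} {y : α}
    (hy : y ∈ B) {f : α → ℤˣ} (hf : IsOutvoted a B y f) :
    ((f y : ℤ) : ℝ) * signSum a univ f < 0 := by
  have hsplit : signSum a univ f =
      signSum a Bᶜ f + (a y * ((f y : ℤ) : ℝ) + signSum a (B.erase y) f) := by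
    rw [← signSum_insert a (notMem_erase y B), insert_erase hy]
    exact (sum_compl_add_sum B _).symm
  have hout : ((f y : ℤ) : ℝ) * signSum a Bᶜ f ≤ ∑ x ∈ Bᶜ, a x :=
    mul_signSum_le_sum (fun x _ => ha x) (f y) f
  rw [hsplit]
  unfold IsOutvoted at hf
  linear_combination hout + a y * cast_units_sq (f y) + hf

theorem dependsOn_isOutvoted (a : α → ℝ) {B : Finset α} {y : α} (hy : y ∈ B) :
    DependsOn (IsOutvoted a B y) (B : Set α) := fun f g hfg => by
  have hsum := dependsOn_signSum a (B.erase y) fun x hx => hfg x (mem_of_mem_erase hx)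
  rw [IsOutvoted, IsOutvoted, hsum, hfg y hy]

theorem one_eighth_le_dens_isOutvoted {a : α → ℝ} (ha : ∀ x, 0 ≤ a x) {B : Finset α} {y : α}
    (hy : y ∈ B) (hay : 0 < a y)
    (hvar : 16 * (a y + ∑ x ∈ Bᶜ, a x) ^ 2 ≤ ∑ x, a x ^ 2) :
    1 / 8 ≤ dens {f | IsOutvoted a B y f} := by
  have hout : 0 ≤ ∑ x ∈ Bᶜ, a x := sum_nonneg fun x _ => ha x
  have hout_sq : ∑ x ∈ Bᶜ, a x ^ 2 ≤ (∑ x ∈ Bᶜ, a x) ^ 2 :=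
    sum_sq_le_sq_sum_of_nonneg fun x _ => ha x
  have hsplit : ∑ x, a x ^ 2 = ∑ x ∈ Bᶜ, a x ^ 2 + (a y ^ 2 + ∑ x ∈ B.erase y, a x ^ 2) := by
    rw [add_sum_erase B (fun x => a x ^ 2) hy, sum_compl_add_sum]
  have herase : 15 * (a y + ∑ x ∈ Bᶜ, a x) ^ 2 ≤ ∑ x ∈ B.erase y, a x ^ 2 := by
    nlinarith [mul_nonneg hay.le hout]
  have hpos : 0 < (a y + ∑ x ∈ Bᶜ, a x) ^ 2 := by positivity
  exact one_eighth_le_dens_mul_signSum_lt (notMem_erase y B) (by linarith) (by linarith)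

theorem dens_not_isOutvoted_le {a : α → ℝ} (ha : ∀ x, 0 ≤ a x) {B : Finset α} {y : α}
    (hy : y ∈ B) (hay : 0 < a y)
    (hvar : 16 * (a y + ∑ x ∈ Bᶜ, a x) ^ 2 ≤ ∑ x, a x ^ 2) :
    dens {f | ¬ IsOutvoted a B y f} ≤ 7 / 8 := by
  have heighth := one_eighth_le_dens_isOutvoted ha hy hay hvar
  have htotal : dens {f | IsOutvoted a B y f} + dens {f | ¬ IsOutvoted a B y f} = 1 := by
    rw [dens_filter_add_dens_filter_not_eq_dens, dens_univ]
  rw [← NNRat.coe_le_coe] at heighth ⊢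
  rw [← NNRat.coe_inj] at htotal
  push_cast at heighth htotal ⊢
  linarith

/-- Being outvoted in `B y` depends only on the values of `f` on `B y`, so for disjoint `B y` these
events are independent. -/
theorem dens_forall_nonneg_mul_signSum_le {a : α → α → ℝ} (ha : ∀ y x, 0 ≤ a y x) {C : Finset α}
    {B : α → Finset α} (hB : (C : Set α).PairwiseDisjoint B) (hmem : ∀ y ∈ C, y ∈ B y)
    (hpos : ∀ y ∈ C, 0 < a y y)
    (hvar : ∀ y ∈ C, 16 * (a y y + ∑ x ∈ (B y)ᶜ, a y x) ^ 2 ≤ ∑ x, a y x ^ 2) :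
    dens {f : α → ℤˣ | ∀ y ∈ C, 0 ≤ ((f y : ℤ) : ℝ) * signSum (a y) univ f} ≤ (7 / 8) ^ #C := by
  have hsub : dens {f | ∀ y ∈ C, 0 ≤ ((f y : ℤ) : ℝ) * signSum (a y) univ f} ≤
      dens {f | ∀ y ∈ C, ¬ IsOutvoted (a y) (B y) y f} := dens_le_dens fun f hf => by
    rw [mem_filter_univ] at hf ⊢
    exact fun y hy hout => (hf y hy).not_gt (hout.mul_signSum_univ_neg (ha y) (hmem y hy))
  have hindep : ∀ y ∈ C, DependsOn (fun f => ¬ IsOutvoted (a y) (B y) y f) (B y : Set α) :=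
    fun y hy f g hfg => congrArg Not (dependsOn_isOutvoted (a y) (hmem y hy) hfg)
  have hprod : dens {f | ∀ y ∈ C, ¬ IsOutvoted (a y) (B y) y f} =
      ∏ y ∈ C, dens {f | ¬ IsOutvoted (a y) (B y) y f} := by
    convert dens_filter_forall_eq_prod_of_dependsOn C _ B hB hindep
  refine (hsub.trans_eq hprod).trans ?_
  exact prod_le_pow_card _ _ _ fun y hy =>
    dens_not_isOutvoted_le (ha y) (hmem y hy) (hpos y hy) (hvar y hy)

end Rademacher

section Entropy

theorem binEnt_eq_binEntropy_div (t : ℝ) : binEnt t = Real.binEntropy t / Real.log 2 := by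
  simp only [binEnt, Real.binEntropy, Real.logb, Real.log_inv]
  ring

theorem continuous_binEnt : Continuous binEnt := by
  simp only [funext binEnt_eq_binEntropy_div]
  fun_prop

theorem concaveOn_binEnt : ConcaveOn ℝ (Set.Icc 0 1) binEnt := by
  simpa only [funext binEnt_eq_binEntropy_div, div_eq_inv_mul, smul_eq_mul] using
    Real.strictConcave_binEntropy.concaveOn.smul (inv_nonneg.2 (Real.log_pos one_lt_two).le)

theorem binDiv_eq_neg_binEnt_sub (p : ℝ) {q : ℝ} (hq0 : 0 < q) (hq1 : q < 1) :
    binDiv p q = -binEnt p - p * Real.logb 2 q - (1 - p) * Real.logb 2 (1 - q) := by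
  have mul_logb_div (s : ℝ) {t : ℝ} (ht : 0 < t) :
      s * Real.logb 2 (s / t) = s * Real.logb 2 s - s * Real.logb 2 t := by
    rcases eq_or_ne s 0 with rfl | hs
    · simp
    · rw [Real.logb_div hs ht.ne', mul_sub]
  rw [binDiv, mul_logb_div p hq0, mul_logb_div (1 - p) (sub_pos.2 hq1), binEnt]
  ring

theorem binDiv_self {q : ℝ} (hq0 : 0 < q) (hq1 : q < 1) : binDiv q q = 0 := by
  rw [binDiv, div_self hq0.ne', div_self (sub_pos.2 hq1).ne']
  simp

theorem binDiv_half (p : ℝ) : binDiv p (1 / 2) = 1 - binEnt p := by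
  have hhalf : Real.logb 2 (1 / 2) = -1 := by
    rw [one_div, Real.logb_inv, Real.logb_self_eq_one one_lt_two]
  rw [binDiv_eq_neg_binEnt_sub p one_half_pos one_half_lt_one, sub_half, hhalf]
  ring

theorem continuous_binDiv {q : ℝ} (hq0 : 0 < q) (hq1 : q < 1) :
    Continuous fun p => binDiv p q := by
  simp only [binDiv_eq_neg_binEnt_sub _ hq0 hq1]
  have := continuous_binEnt
  fun_prop

theorem convexOn_binDiv {q : ℝ} (hq0 : 0 < q) (hq1 : q < 1) :
    ConvexOn ℝ (Set.Icc 0 1) fun p => binDiv p q := by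
  refine ⟨convex_Icc 0 1, fun x hx y hy s t hs ht hst => ?_⟩
  have hent := concaveOn_binEnt.2 hx hy hs ht hst
  simp only [binDiv_eq_neg_binEnt_sub _ hq0 hq1, smul_eq_mul] at hent ⊢
  linear_combination hent + hst * Real.logb 2 (1 - q)

end Entropy

section NoiseKernel

variable {n : ℕ}

/-- The probability that noise with crossover probability `δ` takes `y` to `x`. -/
def noiseKernel (δ : ℝ) (x y : Cube n) : ℝ :=
  ∏ i, if x i = y i then 1 - δ else δ

theorem sum_prod_ite_eq (a b : ℝ) (y : Cube n) :
    ∑ x : Cube n, ∏ i, (if x i = y i then a else b) = (a + b) ^ n := by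
  have hsum (v : ℤˣ) : ∑ u : ℤˣ, (if u = v then a else b) = a + b := by
    rcases Int.units_eq_one_or v with rfl | rfl <;> simp [add_comm]
  rw [← Fintype.prod_sum fun i u => if u = y i then a else b]
  simp only [hsum, prod_const, card_univ, Fintype.card_fin]

theorem sum_noiseKernel (δ : ℝ) (y : Cube n) : ∑ x, noiseKernel δ x y = 1 := by
  rw [show ∑ x, noiseKernel δ x y = _ from sum_prod_ite_eq (1 - δ) δ y, sub_add_cancel, one_pow]

theorem sum_noiseKernel_sq (δ : ℝ) (y : Cube n) :
    ∑ x, noiseKernel δ x y ^ 2 = (δ ^ 2 + (1 - δ) ^ 2) ^ n := by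
  simp only [noiseKernel, ← prod_pow, ite_pow]
  rw [sum_prod_ite_eq, add_comm]

theorem noiseKernel_self (δ : ℝ) (y : Cube n) : noiseKernel δ y y = (1 - δ) ^ n := by
  simp [noiseKernel]

theorem noiseKernel_half (x y : Cube n) : noiseKernel (1 / 2) x y = (1 / 2) ^ n := by
  simp only [noiseKernel, sub_half, ite_self, prod_const, card_univ, Fintype.card_fin]

theorem noiseKernel_pos {δ : ℝ} (hδ0 : 0 < δ) (hδ1 : δ < 1) (x y : Cube n) :
    0 < noiseKernel δ x y :=
  prod_pos fun i _ => by split_ifs <;> linarith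

theorem noiseKernel_eq_pow_mul_pow (δ : ℝ) (x y : Cube n) :
    noiseKernel δ x y = (1 - δ) ^ (n - hammingDist x y) * δ ^ hammingDist x y := by
  have hsame : #{i | x i = y i} = n - hammingDist x y := by
    have h := card_filter_add_card_filter_not (s := univ) fun i => x i = y i
    rw [card_univ, Fintype.card_fin] at h
    exact Nat.eq_sub_of_add_eq h
  rw [noiseKernel, prod_ite, prod_const, prod_const, hsame, hammingDist]

theorem hammingDist_le_length (x y : Cube n) : hammingDist x y ≤ n := by
  simpa using hammingDist_le_card_fintype (x := x) (y := y)

theorem logb_noiseKernel {δ : ℝ} (hδ0 : 0 < δ) (hδ1 : δ < 1) (x y : Cube n) :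
    Real.logb 2 (noiseKernel δ x y) =
      (n - hammingDist x y) * Real.logb 2 (1 - δ) + hammingDist x y * Real.logb 2 δ := by
  rw [noiseKernel_eq_pow_mul_pow, Real.logb_mul (pow_pos (sub_pos.2 hδ1) _).ne' (pow_pos hδ0 _).ne',
    Real.logb_pow, Real.logb_pow, Nat.cast_sub (hammingDist_le_length x y)]

/-- The exponential change of measure behind the Chernoff bound: on the side of the sphere of radius
`η * n` that is away from `δ * n`, the kernels differ by at least the factor on the sphere. -/
theorem noiseKernel_le_rpow_mul_noiseKernel {δ η : ℝ} (hδ0 : 0 < δ) (hδ1 : δ < 1) (hη0 : 0 < η)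
    (hη1 : η < 1) {x y : Cube n} (hxy : (δ - η) * (hammingDist x y - η * n) ≤ 0) :
    noiseKernel δ x y ≤ 2 ^ (-(n * binDiv η δ)) * noiseKernel η x y := by
  have hlogOdds : (Real.logb 2 δ - Real.logb 2 (1 - δ) - (Real.logb 2 η - Real.logb 2 (1 - η))) *
      (hammingDist x y - η * n) ≤ 0 := by
    have mono {s t : ℝ} (hs : 0 < s) (ht : t < 1) (hst : s < t) :
        Real.logb 2 s - Real.logb 2 (1 - s) < Real.logb 2 t - Real.logb 2 (1 - t) :=
      sub_lt_sub (Real.logb_lt_logb one_lt_two hs hst)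
        (Real.logb_lt_logb one_lt_two (sub_pos.2 ht) (by linarith))
    rcases lt_trichotomy δ η with h | rfl | h
    · exact mul_nonpos_of_nonpos_of_nonneg (sub_nonpos.2 (mono hδ0 hη1 h).le)
        (by nlinarith)
    · simp
    · exact mul_nonpos_of_nonneg_of_nonpos (sub_nonneg.2 (mono hη0 hδ1 h).le)
        (by nlinarith)
  have hηpos := noiseKernel_pos hη0 hη1 x y
  rw [← Real.logb_le_logb one_lt_two (noiseKernel_pos hδ0 hδ1 x y) (by positivity),
    Real.logb_mul (by positivity) hηpos.ne', Real.logb_rpow two_pos (by norm_num),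
    logb_noiseKernel hδ0 hδ1, logb_noiseKernel hη0 hη1, binDiv_eq_neg_binEnt_sub η hδ0 hδ1, binEnt]
  linear_combination hlogOdds

theorem sum_noiseKernel_le_rpow {δ η : ℝ} (hδ0 : 0 < δ) (hδ1 : δ < 1) (hη0 : 0 < η) (hη1 : η < 1)
    {y : Cube n} {s : Finset (Cube n)}
    (hs : ∀ x ∈ s, (δ - η) * (hammingDist x y - η * n) ≤ 0) :
    ∑ x ∈ s, noiseKernel δ x y ≤ 2 ^ (-(n * binDiv η δ)) :=
  calc ∑ x ∈ s, noiseKernel δ x y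
      ≤ ∑ x ∈ s, 2 ^ (-(n * binDiv η δ)) * noiseKernel η x y :=
        sum_le_sum fun x hx => noiseKernel_le_rpow_mul_noiseKernel hδ0 hδ1 hη0 hη1 (hs x hx)
    _ = 2 ^ (-(n * binDiv η δ)) * ∑ x ∈ s, noiseKernel η x y := (mul_sum ..).symm
    _ ≤ 2 ^ (-(n * binDiv η δ)) * ∑ x, noiseKernel η x y := by
        gcongr
        · exact fun x _ _ => (noiseKernel_pos hη0 hη1 x y).le
        · exact subset_univ s
    _ = 2 ^ (-(n * binDiv η δ)) := by rw [sum_noiseKernel, mul_one]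

end NoiseKernel

section HammingBall

variable {ι : Type*} [Fintype ι] [DecidableEq ι] {A : Type*} [Fintype A] [DecidableEq A]

/-- The closed ball of radius `r` about `y` for the Hamming distance. -/
noncomputable def hammingBall (y : ι → A) (r : ℝ) : Finset (ι → A) :=
  {x | (hammingDist x y : ℝ) ≤ r}

theorem mem_hammingBall {x y : ι → A} {r : ℝ} :
    x ∈ hammingBall y r ↔ (hammingDist x y : ℝ) ≤ r := mem_filter_univ x

theorem mem_hammingBall_self (y : ι → A) {r : ℝ} (hr : 0 ≤ r) : y ∈ hammingBall y r := by
  simpa [mem_hammingBall] using hr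

theorem disjoint_hammingBall {y z : ι → A} {r : ℝ} (hyz : 2 * r < hammingDist y z) :
    Disjoint (hammingBall y r) (hammingBall z r) := by
  refine disjoint_left.2 fun x hxy hxz => hyz.not_ge ?_
  rw [mem_hammingBall] at hxy hxz
  have htriangle : (hammingDist y z : ℝ) ≤ hammingDist x y + hammingDist x z :=
    mod_cast hammingDist_triangle_left y z x
  linarith

theorem exists_pairwise_lt_hammingDist_one_le_sum_dens [Nonempty A] {r : ℝ} (hr : 0 ≤ r) :
    ∃ C : Finset (ι → A), (C : Set (ι → A)).Pairwise (fun y z => r < hammingDist y z) ∧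
      1 ≤ ∑ y ∈ C, (hammingBall y r).dens := by
  obtain ⟨C, hC⟩ := exists_maximal_of_wellFoundedGT
    (P := fun C : Finset (ι → A) => (C : Set (ι → A)).Pairwise fun y z => r < hammingDist y z)
    ⟨∅, by simp⟩
  refine ⟨C, hC.prop, ?_⟩
  have hcover : C.biUnion (hammingBall · r) = univ := by
    refine eq_univ_of_forall fun x => ?_
    by_contra! hx
    simp only [mem_biUnion, mem_hammingBall, not_exists, not_and, not_le] at hx
    have : Std.Symm fun y z : ι → A => r < hammingDist y z :=
      ⟨fun y z h => by rwa [hammingDist_comm]⟩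
    have hinsert : ((insert x C : Finset (ι → A)) : Set (ι → A)).Pairwise
        fun y z => r < hammingDist y z := by
      rw [coe_insert]
      exact hC.prop.insert_of_symm fun y hy _ => hx y hy
    have hxC : x ∈ C := hC.le_of_ge hinsert (subset_insert x C) (mem_insert_self x C)
    simpa using hr.trans_lt (hx x hxC)
  calc (1 : ℚ≥0) = (C.biUnion (hammingBall · r)).dens := by rw [hcover, dens_univ]
    _ ≤ ∑ y ∈ C, (hammingBall y r).dens := dens_biUnion_le

end HammingBall

section Code

variable {n : ℕ}

theorem dens_hammingBall_le_rpow {l : ℝ} (hl0 : 0 < l) (hl : l ≤ 1 / 2) (y : Cube n) :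
    ((hammingBall y (l * n)).dens : ℝ) ≤ 2 ^ (-(n * (1 - binEnt l))) := by
  have hdens : ((hammingBall y (l * n)).dens : ℝ) =
      ∑ x ∈ hammingBall y (l * n), noiseKernel (1 / 2) x y := by
    have hcube : Fintype.card (Cube n) = 2 ^ n := by
      rw [Fintype.card_fun, Fintype.card_units_int, Fintype.card_fin]
    rw [dens, hcube]
    simp only [noiseKernel_half, sum_const, nsmul_eq_mul, one_div_pow, mul_one_div]
    push_cast
    rfl
  rw [hdens, ← binDiv_half]
  refine sum_noiseKernel_le_rpow one_half_pos one_half_lt_one hl0 (by linarith) fun x hx => ?_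
  exact mul_nonpos_of_nonneg_of_nonpos (by linarith) (sub_nonpos.2 (mem_hammingBall.1 hx))

theorem exists_pairwise_lt_hammingDist_rpow_le_card {l : ℝ} (hl0 : 0 < l) (hl : l ≤ 1 / 2) (n : ℕ) :
    ∃ C : Finset (Cube n), (C : Set (Cube n)).Pairwise (fun y z => l * n < hammingDist y z) ∧
      2 ^ (n * (1 - binEnt l)) ≤ (#C : ℝ) := by
  obtain ⟨C, hsep, hcover⟩ := exists_pairwise_lt_hammingDist_one_le_sum_dens (ι := Fin n) (A := ℤˣ)
    (show 0 ≤ l * n by positivity)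
  refine ⟨C, hsep, ?_⟩
  have hcard : (1 : ℝ) ≤ #C * 2 ^ (-(n * (1 - binEnt l))) :=
    calc (1 : ℝ) ≤ ∑ y ∈ C, ((hammingBall y (l * n)).dens : ℝ) := mod_cast hcover
      _ ≤ #C • (2 : ℝ) ^ (-(n * (1 - binEnt l))) :=
        sum_le_card_nsmul _ _ _ fun y _ => dens_hammingBall_le_rpow hl0 hl y
      _ = #C * 2 ^ (-(n * (1 - binEnt l))) := nsmul_eq_mul _ _
  rwa [Real.rpow_neg two_pos.le, ← div_eq_mul_inv, one_le_div (by positivity)] at hcard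

end Code

section Radius

variable {δ : ℝ}

/-- The left-hand side of `EtaCondition`, which is the decay rate of a standard deviation: for
uniformly random `f`, the conditional expectation of `f(X^n)` given `Y^n` has standard
deviation `2 ^ (-(n * stdDevRate δ))`. -/
noncomputable def stdDevRate (δ : ℝ) : ℝ :=
  1 / 2 * Real.logb 2 (1 / (δ ^ 2 + (1 - δ) ^ 2))

theorem logb_sq_add_sq (δ : ℝ) : Real.logb 2 (δ ^ 2 + (1 - δ) ^ 2) = -(2 * stdDevRate δ) := by
  rw [stdDevRate, one_div (_ + _), Real.logb_inv]
  ring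

theorem sq_add_one_sub_sq_pos (δ : ℝ) : 0 < δ ^ 2 + (1 - δ) ^ 2 := by
  nlinarith [sq_nonneg (2 * δ - 1)]

theorem stdDevRate_lt_logb_one_div {t : ℝ} (ht : 0 < t) (htδ : t ^ 2 < δ ^ 2 + (1 - δ) ^ 2) :
    stdDevRate δ < Real.logb 2 (1 / t) := by
  have h := Real.logb_lt_logb one_lt_two (pow_pos ht 2) htδ
  rw [logb_sq_add_sq, Real.logb_pow, Nat.cast_ofNat] at h
  rw [one_div, Real.logb_inv]
  linarith

theorem stdDevRate_pos (hδ0 : 0 < δ) (hδ1 : δ < 1) : 0 < stdDevRate δ := by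
  have h := Real.logb_neg one_lt_two (sq_add_one_sub_sq_pos δ) (by nlinarith)
  rw [logb_sq_add_sq] at h
  linarith

theorem etaCondition_iff (hδ0 : 0 < δ) (hδ1 : δ < 1) {η : ℝ} :
    EtaCondition δ η ↔ stdDevRate δ < binDiv η δ := by
  have hself : stdDevRate δ < Real.logb 2 (1 / (1 - δ)) :=
    stdDevRate_lt_logb_one_div (sub_pos.2 hδ1) (lt_add_of_pos_left _ (pow_pos hδ0 2))
  rw [EtaCondition, lt_min_iff]
  exact and_iff_right hself

theorem stdDevRate_lt_binDiv_one (hδ0 : 0 < δ) (hδ1 : δ < 1) : stdDevRate δ < binDiv 1 δ := by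
  have hone : binDiv 1 δ = Real.logb 2 (1 / δ) := by simp [binDiv]
  rw [hone]
  exact stdDevRate_lt_logb_one_div hδ0 (lt_add_of_pos_right _ (pow_pos (sub_pos.2 hδ1) 2))

theorem eta_lt_iff (hδ0 : 0 < δ) {r : ℝ} (hδr : δ < r) (hr : r ≤ 1) :
    eta δ < r ↔ stdDevRate δ < binDiv r δ := by
  have hδ1 : δ < 1 := hδr.trans_le hr
  constructor
  · intro h
    have hne : {η | δ < η ∧ η ≤ 1 ∧ EtaCondition δ η}.Nonempty :=
      ⟨1, hδ1, le_rfl, (etaCondition_iff hδ0 hδ1).2 (stdDevRate_lt_binDiv_one hδ0 hδ1)⟩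
    obtain ⟨η, ⟨hδη, -, hη⟩, hηr⟩ := exists_lt_of_csInf_lt hne h
    have hmax : binDiv η δ ≤ max (binDiv δ δ) (binDiv r δ) :=
      (convexOn_binDiv hδ0 hδ1).le_max_of_mem_Icc ⟨hδ0.le, hδ1.le⟩ ⟨(hδ0.trans hδr).le, hr⟩
        ⟨hδη.le, hηr.le⟩
    rw [binDiv_self hδ0 hδ1] at hmax
    have hlt := ((etaCondition_iff hδ0 hδ1).1 hη).trans_le hmax
    exact (lt_max_iff.1 hlt).resolve_left (stdDevRate_pos hδ0 hδ1).not_gt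
  · intro h
    have hnear : ∀ᶠ η in nhdsWithin r (Set.Iio r), stdDevRate δ < binDiv η δ :=
      ((continuous_binDiv hδ0 hδ1).tendsto r |>.eventually_const_lt h).filter_mono
        nhdsWithin_le_nhds
    obtain ⟨η, hη, hδη, hηr⟩ := (hnear.and (Ioo_mem_nhdsLT hδr)).exists
    have hle : eta δ ≤ η := csInf_le ⟨δ, fun _ h => h.1.le⟩
      ⟨hδη, hηr.le.trans hr, (etaCondition_iff hδ0 hδ1).2 hη⟩
    exact hle.trans_lt hηr

theorem lt_eta (hδ0 : 0 < δ) (hδ1 : δ < 1) : δ < eta δ := by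
  have hself : binDiv δ δ < stdDevRate δ := by
    rw [binDiv_self hδ0 hδ1]
    exact stdDevRate_pos hδ0 hδ1
  have hnear : ∀ᶠ η in nhdsWithin δ (Set.Ioi δ), binDiv η δ < stdDevRate δ :=
    ((continuous_binDiv hδ0 hδ1).tendsto δ |>.eventually_lt_const hself).filter_mono
      nhdsWithin_le_nhds
  obtain ⟨η, hη, hδη, hη1⟩ := (hnear.and (Ioo_mem_nhdsGT hδ1)).exists
  exact hδη.trans_le (not_lt.1 fun h => hη.not_gt ((eta_lt_iff hδ0 hδη hη1.le).1 h))

end Radius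

section Threshold

variable {δ : ℝ}

/-- The polynomial whose sign decides whether `eta δ < 1 / 4`: the numerator minus the denominator
of the fraction whose binary logarithm is `4 * (binDiv (1 / 4) δ - stdDevRate δ)`. -/
def quarterGap (δ : ℝ) : ℝ := 27 * (δ ^ 2 + (1 - δ) ^ 2) ^ 2 - 256 * (δ * (1 - δ) ^ 3)

theorem four_mul_binDiv_quarter_sub_stdDevRate (hδ0 : 0 < δ) (hδ1 : δ < 1) :
    4 * (binDiv (1 / 4) δ - stdDevRate δ) =
      Real.logb 2 (27 * (δ ^ 2 + (1 - δ) ^ 2) ^ 2 / (256 * (δ * (1 - δ) ^ 3))) := by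
  have hδ' : 0 < 1 - δ := sub_pos.2 hδ1
  have := sq_add_one_sub_sq_pos δ
  have hbinDiv : 4 * binDiv (1 / 4) δ =
      Real.logb 2 (1 / 4 / δ * ((1 - 1 / 4) / (1 - δ)) ^ 3) := by
    rw [Real.logb_mul (by positivity) (by positivity), Real.logb_pow, binDiv]
    push_cast
    ring
  have hstdDev : 4 * stdDevRate δ = -Real.logb 2 ((δ ^ 2 + (1 - δ) ^ 2) ^ 2) := by
    rw [Real.logb_pow, logb_sq_add_sq]
    push_cast
    ring
  rw [mul_sub, hbinDiv, hstdDev, sub_neg_eq_add, ← Real.logb_mul (by positivity) (by positivity)]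
  congr 1
  field_simp
  norm_num

theorem eta_lt_quarter_iff (hδ0 : 0 < δ) (hδ : δ < 1 / 4) :
    eta δ < 1 / 4 ↔ 0 < quarterGap δ := by
  have hδ1 : δ < 1 := by linarith
  have hnum : 0 < 27 * (δ ^ 2 + (1 - δ) ^ 2) ^ 2 :=
    mul_pos (by norm_num) (pow_pos (sq_add_one_sub_sq_pos δ) 2)
  have hden : 0 < 256 * (δ * (1 - δ) ^ 3) :=
    mul_pos (by norm_num) (mul_pos hδ0 (pow_pos (sub_pos.2 hδ1) 3))
  rw [eta_lt_iff hδ0 hδ (by norm_num), ← sub_pos, ← mul_pos_iff_of_pos_left four_pos,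
    four_mul_binDiv_quarter_sub_stdDevRate hδ0 hδ1,
    Real.logb_pos_iff one_lt_two (div_pos hnum hden), one_lt_div hden, quarterGap, sub_pos]

theorem strictAntiOn_quarterGap : StrictAntiOn quarterGap (Set.Icc 0 (1 / 8)) := by
  rintro x ⟨hx0, hx⟩ y ⟨hy0, hy⟩ hxy
  have hfactor : quarterGap x - quarterGap y =
      (y - x) * (364 - 984 * (x + y) + 984 * (x ^ 2 + x * y + y ^ 2) -
        364 * ((x + y) * (x ^ 2 + y ^ 2))) := by
    unfold quarterGap
    ring
  have hcubic : (x + y) * (x ^ 2 + y ^ 2) ≤ (1 / 8 + 1 / 8) * ((1 / 8) ^ 2 + (1 / 8) ^ 2) := by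
    gcongr
  rw [← sub_pos, hfactor]
  refine mul_pos (sub_pos.2 hxy) ?_
  nlinarith [mul_nonneg hx0 hy0]

theorem abs_deltaMax_sub_le : |deltaMax - 0.0974| ≤ 0.00005 := by
  have hlower : 0.09735 ≤ deltaMax := by
    refine le_csSup ⟨1 / 2, fun d hd => hd.2.1⟩
      ⟨by norm_num, by norm_num, fun δ hδ0 hδ => ?_⟩
    rw [eta_lt_quarter_iff hδ0 (by linarith)]
    calc 0 < quarterGap 0.09735 := by norm_num [quarterGap]
      _ < quarterGap δ := strictAntiOn_quarterGap ⟨hδ0.le, by linarith⟩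
        ⟨by norm_num, by norm_num⟩ hδ
  have hupper : deltaMax ≤ 0.09745 := by
    refine csSup_le ⟨0, le_rfl, by norm_num, fun δ h0 h => (h0.not_gt h).elim⟩ fun d hd => ?_
    by_contra! hlt
    have hgap := (eta_lt_quarter_iff (by norm_num) (by norm_num)).1 (hd.2.2 _ (by norm_num) hlt)
    norm_num [quarterGap] at hgap
  rw [abs_le]
  constructor <;> linarith

theorem deltaMax_le_quarter : deltaMax ≤ 1 / 4 := by
  linarith [(abs_le.1 abs_deltaMax_sub_le).2]

theorem eta_lt_quarter_of_lt_deltaMax (hδ0 : 0 < δ) (hδ : δ < deltaMax) : eta δ < 1 / 4 := by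
  have hne : {d : ℝ | 0 ≤ d ∧ d ≤ 1 / 2 ∧ ∀ δ : ℝ, 0 < δ → δ < d → eta δ < 1 / 4}.Nonempty :=
    ⟨0, le_rfl, by norm_num, fun δ h0 h => (h0.not_gt h).elim⟩
  obtain ⟨d, hd, hδd⟩ := exists_lt_of_lt_csSup hne hδ
  exact hd.2.2 δ hδ0 hδd

end Threshold

section SelfPrediction

variable {n : ℕ}

theorem IsSPAt.mul_noiseOp_nonneg {ρ : ℝ} {f : BoolFn n} {y : Cube n} (hf : IsSPAt ρ f y) :
    0 ≤ ((f y : ℤ) : ℝ) * noiseOp ρ f y := by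
  by_cases htie : noiseOp ρ f y = 0
  · rw [htie, mul_zero]
  · rw [hf htie]
    exact Real.sign_mul_nonneg _

theorem condProb_eq_noiseKernel (δ : ℝ) (x y : Cube n) : condProb δ x y = noiseKernel δ x y := by
  have hjoint (z : Cube n) : jointProb δ z y = 1 / 2 ^ n * noiseKernel δ z y := rfl
  simp only [condProb, hjoint, ← mul_sum, sum_noiseKernel, mul_one]
  exact mul_div_cancel_left₀ _ (by positivity)

theorem noiseOp_eq_signSum (δ : ℝ) (f : BoolFn n) (y : Cube n) :
    noiseOp (1 - 2 * δ) f y = signSum (noiseKernel δ · y) univ f := by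
  have hδ : (1 - (1 - 2 * δ)) / 2 = δ := by ring
  simp only [noiseOp, signSum, hδ, condProb_eq_noiseKernel]

theorem fractionSP_eq_dens (ρ : ℝ) (n : ℕ) [DecidablePred (IsSP ρ (n := n))] :
    fractionSP ρ n = (dens {f : BoolFn n | IsSP ρ f} : ℝ) := by
  rw [fractionSP, Nat.card_eq_fintype_card, Nat.card_eq_fintype_card, Fintype.card_subtype, dens]
  push_cast
  rfl

theorem sum_noiseKernel_compl_hammingBall_le {δ η : ℝ} (hδ0 : 0 < δ) (hδη : δ < η) (hη1 : η < 1)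
    (y : Cube n) :
    ∑ x ∈ (hammingBall y (η * n))ᶜ, noiseKernel δ x y ≤ 2 ^ (-(n * binDiv η δ)) :=
  sum_noiseKernel_le_rpow hδ0 (hδη.trans hη1) (hδ0.trans hδη) hη1 fun x hx => by
    rw [mem_compl, mem_hammingBall, not_le] at hx
    exact mul_nonpos_of_nonpos_of_nonneg (sub_nonpos.2 hδη.le) (sub_nonneg.2 hx.le)

theorem fractionSP_le_pow_card {δ η : ℝ} (hδ0 : 0 < δ) (hδη : δ < η) (hη1 : η < 1)
    (hvar : 16 * ((1 - δ) ^ n + 2 ^ (-(n * binDiv η δ))) ^ 2 ≤ (δ ^ 2 + (1 - δ) ^ 2) ^ n)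
    {C : Finset (Cube n)}
    (hC : (C : Set (Cube n)).Pairwise fun y z => 2 * η * n < hammingDist y z) :
    fractionSP (1 - 2 * δ) n ≤ (7 / 8) ^ #C := by
  classical
  have hδ1 : δ < 1 := hδη.trans hη1
  have hnonneg (y x : Cube n) : 0 ≤ noiseKernel δ x y := (noiseKernel_pos hδ0 hδ1 x y).le
  have hdisj : (C : Set (Cube n)).PairwiseDisjoint fun y => hammingBall y (η * n) :=
    fun y hy z hz hyz => disjoint_hammingBall (by rw [← mul_assoc]; exact hC hy hz hyz)
  have hradius : 0 ≤ η * n := mul_nonneg (hδ0.trans hδη).le n.cast_nonneg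
  have hvar' (y : Cube n) :
      16 * (noiseKernel δ y y + ∑ x ∈ (hammingBall y (η * n))ᶜ, noiseKernel δ x y) ^ 2 ≤
        ∑ x, noiseKernel δ x y ^ 2 := by
    rw [sum_noiseKernel_sq, noiseKernel_self]
    refine le_trans ?_ hvar
    have : 0 ≤ (1 - δ) ^ n := pow_nonneg (sub_nonneg.2 hδ1.le) n
    have hout : 0 ≤ ∑ x ∈ (hammingBall y (η * n))ᶜ, noiseKernel δ x y :=
      sum_nonneg fun x _ => hnonneg y x
    gcongr
    exact sum_noiseKernel_compl_hammingBall_le hδ0 hδη hη1 y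
  have hdens := dens_forall_nonneg_mul_signSum_le hnonneg hdisj
    (fun y _ => mem_hammingBall_self y hradius) (fun y _ => noiseKernel_pos hδ0 hδ1 y y)
    fun y _ => hvar' y
  have hsub : dens {f : BoolFn n | IsSP (1 - 2 * δ) f} ≤
      dens {f : BoolFn n | ∀ y ∈ C, 0 ≤ ((f y : ℤ) : ℝ) * signSum (noiseKernel δ · y) univ f} :=
    dens_le_dens <| monotone_filter_right _ fun f _ hf y _ => by
      rw [← noiseOp_eq_signSum]
      exact (hf y).mul_noiseOp_nonneg
  rw [fractionSP_eq_dens]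
  exact (NNRat.cast_mono (hsub.trans hdens)).trans_eq (by norm_num)

theorem fractionSP_le_exp {δ η : ℝ} (hδ0 : 0 < δ) (hδη : δ < η) (hη : η ≤ 1 / 4)
    (hvar : 16 * ((1 - δ) ^ n + 2 ^ (-(n * binDiv η δ))) ^ 2 ≤ (δ ^ 2 + (1 - δ) ^ 2) ^ n) :
    fractionSP (1 - 2 * δ) n ≤ Real.exp (-(2 ^ (n * (1 - binEnt (2 * η))) / 8)) := by
  obtain ⟨C, hC, hcard⟩ := exists_pairwise_lt_hammingDist_rpow_le_card
    (show 0 < 2 * η by linarith) (by linarith) n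
  calc fractionSP (1 - 2 * δ) n
      ≤ (7 / 8) ^ #C := fractionSP_le_pow_card hδ0 hδη (by linarith) hvar hC
    _ ≤ Real.exp (-(1 / 8)) ^ #C := by
        gcongr
        linarith [Real.one_sub_le_exp_neg (1 / 8)]
    _ = Real.exp (-(#C / 8)) := by rw [← Real.exp_nat_mul]; ring_nf
    _ ≤ Real.exp (-(2 ^ (n * (1 - binEnt (2 * η))) / 8)) := by gcongr

end SelfPrediction

section Asymptotics

theorem isLittleO_add_pow_sq {p q s : ℝ} (hp : p ^ 2 < s) (hq : q ^ 2 < s) :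
    (fun n : ℕ => (p ^ n + q ^ n) ^ 2) =o[atTop] (s ^ · : ℕ → ℝ) := by
  have hpow {r : ℝ} (hr : |r| < s) : (r ^ · : ℕ → ℝ) =o[atTop] (s ^ · : ℕ → ℝ) :=
    isLittleO_pow_pow_of_abs_lt_left (hr.trans_le (le_abs_self s))
  have hpq : |p * q| < s := abs_lt.2 ⟨by nlinarith [sq_nonneg (p + q)],
    by nlinarith [sq_nonneg (p - q)]⟩
  have hsum := ((hpow ((abs_sq p).trans_lt hp)).add ((hpow hpq).const_mul_left 2)).add
    (hpow ((abs_sq q).trans_lt hq))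
  exact hsum.congr_left fun n => by ring

theorem eventually_variance_bound {δ D : ℝ} (hδ0 : 0 < δ) (hD : stdDevRate δ < D) :
    ∀ᶠ n : ℕ in atTop,
      16 * ((1 - δ) ^ n + 2 ^ (-(n * D))) ^ 2 ≤ (δ ^ 2 + (1 - δ) ^ 2) ^ n := by
  have hs := sq_add_one_sub_sq_pos δ
  have htail : ((2 : ℝ) ^ (-D)) ^ 2 < δ ^ 2 + (1 - δ) ^ 2 := by
    rw [← Real.logb_lt_logb_iff one_lt_two (by positivity) hs, logb_sq_add_sq, Real.logb_pow,
      Real.logb_rpow two_pos (by norm_num)]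
    push_cast
    linarith
  have hself : (1 - δ) ^ 2 < δ ^ 2 + (1 - δ) ^ 2 := lt_add_of_pos_left _ (pow_pos hδ0 2)
  filter_upwards [(isLittleO_add_pow_sq hself htail).bound (show (0 : ℝ) < 1 / 16 by norm_num)]
    with n hn
  have hpow : (2 : ℝ) ^ (-(n * D)) = (2 ^ (-D)) ^ n := by
    rw [← Real.rpow_mul_natCast two_pos.le, mul_comm, neg_mul]
  rw [Real.norm_of_nonneg (sq_nonneg _), Real.norm_of_nonneg (by positivity)] at hn
  rw [hpow]
  linarith

theorem eventually_fractionSP_le {δ : ℝ} (hδ0 : 0 < δ) (hδ1 : δ < 1) (hη : eta δ < 1 / 4)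
    {ε : ℝ} (hε : 0 < ε) :
    ∀ᶠ n : ℕ in atTop, fractionSP (1 - 2 * δ) n ≤
      Real.exp (-(2 ^ (n * (1 - binEnt (2 * eta δ)) - ε * n))) := by
  have hδη := lt_eta hδ0 hδ1
  have hent : ∀ᶠ η in nhdsWithin (eta δ) (Set.Ioi (eta δ)),
      binEnt (2 * η) < binEnt (2 * eta δ) + ε / 2 :=
    ((continuous_binEnt.comp (continuous_const_mul 2)).tendsto (eta δ)
      |>.eventually_lt_const (lt_add_of_pos_right _ (half_pos hε))).filter_mono nhdsWithin_le_nhds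
  obtain ⟨η, hη_ent, heta_lt, hη_lt⟩ := (hent.and (Ioo_mem_nhdsGT hη)).exists
  have hrate : stdDevRate δ < binDiv η δ :=
    (eta_lt_iff hδ0 (hδη.trans heta_lt) (by linarith)).1 heta_lt
  filter_upwards [eventually_variance_bound hδ0 hrate,
    tendsto_natCast_atTop_atTop.eventually_ge_atTop (6 / ε)] with n hvar hn
  refine (fractionSP_le_exp hδ0 (hδη.trans heta_lt) hη_lt.le hvar).trans ?_
  have hloss : 3 ≤ ε / 2 * n := by
    rw [div_le_iff₀ hε] at hn
    linarith
  have hexponent : n * (1 - binEnt (2 * eta δ)) - ε * n ≤ n * (1 - binEnt (2 * η)) - 3 := by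
    linear_combination hloss + (n : ℝ) * hη_ent.le
  rw [show (8 : ℝ) = 2 ^ (3 : ℝ) by norm_num, ← Real.rpow_sub two_pos]
  exact Real.exp_le_exp.2 <| neg_le_neg <|
    Real.rpow_le_rpow_of_exponent_le one_le_two hexponent

theorem exists_tendsto_atTop_eventually {p : ℕ → ℕ → Prop} (hp : ∀ k, ∀ᶠ n in atTop, p k n) :
    ∃ φ : ℕ → ℕ, Tendsto φ atTop atTop ∧ ∀ᶠ n in atTop, p (φ n) n := by
  classical
  refine ⟨fun n => Nat.findGreatest (fun k => ∀ m ≥ n, p k m) n, tendsto_atTop.2 fun k => ?_, ?_⟩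
  · filter_upwards [eventually_forall_ge_atTop.2 (hp k), eventually_ge_atTop k] with n hn hkn
    exact Nat.le_findGreatest hkn hn
  · filter_upwards [eventually_forall_ge_atTop.2 (hp 0)] with n hn
    exact Nat.findGreatest_spec (P := fun k => ∀ m ≥ n, p k m) n.zero_le hn n le_rfl

theorem exists_isLittleO_eventually (p : ℝ → ℕ → Prop) {g : ℕ → ℝ}
    (hp : ∀ ε > 0, ∀ᶠ n in atTop, p (ε * g n) n) :
    ∃ e : ℕ → ℝ, e =o[atTop] g ∧ ∀ᶠ n in atTop, p (e n) n := by
  obtain ⟨φ, hφ, hpφ⟩ := exists_tendsto_atTop_eventually fun k : ℕ =>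
    hp (1 / ((k : ℝ) + 1)) Nat.one_div_pos_of_nat
  refine ⟨fun n => 1 / ((φ n : ℝ) + 1) * g n, ?_, hpφ⟩
  have hzero : (fun n => 1 / ((φ n : ℝ) + 1)) =o[atTop] fun _ => (1 : ℝ) :=
    (isLittleO_one_iff ℝ).2 (tendsto_one_div_add_atTop_nhds_zero_nat.comp hφ)
  simpa only [one_mul] using hzero.mul_isBigO (isBigO_refl g atTop)

end Asymptotics

end SelfPredicting

theorem mainTheorem2 :
    |SelfPredicting.deltaMax - 0.0974| ≤ 0.00005 ∧
    ∀ δ : ℝ, 0 < δ → δ < SelfPredicting.deltaMax →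
      (δ < SelfPredicting.eta δ ∧ SelfPredicting.eta δ < 1 / 4) ∧
      ∃ e : ℕ → ℝ, e =o[atTop] (fun n : ℕ => (n : ℝ)) ∧
        ∀ᶠ n : ℕ in atTop,
          SelfPredicting.fractionSP (1 - 2 * δ) n ≤
            Real.exp (-((2 : ℝ) ^
              ((n : ℝ) * (1 - SelfPredicting.binEnt (2 * SelfPredicting.eta δ)) - e n))) := by
  refine ⟨SelfPredicting.abs_deltaMax_sub_le, fun δ hδ0 hδ => ?_⟩
  have hδ1 : δ < 1 := by linarith [SelfPredicting.deltaMax_le_quarter]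
  have hη : SelfPredicting.eta δ < 1 / 4 := SelfPredicting.eta_lt_quarter_of_lt_deltaMax hδ0 hδ
  refine ⟨⟨SelfPredicting.lt_eta hδ0 hδ1, hη⟩, ?_⟩
  exact SelfPredicting.exists_isLittleO_eventually
    (fun t n => SelfPredicting.fractionSP (1 - 2 * δ) n ≤ Real.exp (-((2 : ℝ) ^
      ((n : ℝ) * (1 - SelfPredicting.binEnt (2 * SelfPredicting.eta δ)) - t))))
    fun ε hε => SelfPredicting.eventually_fractionSP_le hδ0 hδ1 hη hε
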